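/- A stabilizer ZX-calculus diagram is built from green nodes and red nodes with any numbers $n\ge 0$ of inputs and $m\ge 0$ of outputs and a phase in $\{0,\pi/2,\pi,-\pi/2\}$, Hadamard nodes (one input, one output), star nodes (no inputs or outputs), and edges (straight, crossing, or bent into cups and caps), by placing diagrams side by side and connecting outputs to inputs; the empty diagram is allowed. The interpretation $\llbracket D\rrbracket$ of a diagram $D$ with $n$ inputs and $m$ outputs is the complex $2^m\times 2^n$ matrix determined as follows. A green node with phase $\alpha$ is interpreted as $|0\rangle^{\otimes m}\langle 0|^{\otimes n}+e^{i\alpha}|1\rangle^{\otimes m}\langle 1|^{\otimes n}$, and a red node with phase $\beta$ as $|+\rangle^{\otimes m}\langle +|^{\otimes n}+e^{i\beta}|-\rangle^{\otimes m}\langle -|^{\otimes n}$, where $|\pm\rangle=\frac{1}{\sqrt2}(|0\rangle\pm|1\rangle)$ and zero-fold tensor powers are $1$. A Hadamard node is interpreted as $|+\rangle\langle 0|+|-\rangle\langle 1|$, a star node as $\frac12$, and the empty diagram as $1$. A straight edge is the identity on $\mathbb{C}^2$, a crossing is the swap of two qubits, a cup is $|00\rangle+|11\rangle$, and a cap is $\langle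 00|+\langle 11|$. Placing side by side is the tensor product, and connecting outputs to inputs is matrix multiplication. A scalar diagram is one with no inputs and no outputs; its interpretation is a complex number. Proposition. Let $D$ be a stabilizer scalar diagram with $\llbracket D\rrbracket\neq 0$. Then $$\llbracket D\rrbracket\in\left\{\sqrt{2^r}\,e^{is\pi/4} \;\middle|\; r,s\in\mathbb{Z}\right\}.$$ -/

import Mathlib

noncomputable section

/-- The phase labels `0, π/2, π, -π/2` of the stabilizer fragment. -/
inductive StabPhase : Type
  | zero
  | halfPi
  | pi
  | negHalfPi

/-- The angle, a real number, of a phase label. -/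
def StabPhase.angle : StabPhase → ℝ
  | .zero => 0
  | .halfPi => Real.pi / 2
  | .pi => Real.pi
  | .negHalfPi => -(Real.pi / 2)

/-- `StabDiagram n m` is the type of stabilizer ZX-calculus diagrams with `n` inputs and `m`
outputs. A diagram is assembled from green and red nodes with any numbers of inputs and outputs,
Hadamard nodes and star nodes by drawing them side by side (`tensor`), by connecting the outputs of
one diagram to the inputs of another one (`comp`), and by running edges straight (`wire`), across
each other (`swap`) or bent (`cup`, `cap`). `empty` is the empty diagram. -/
inductive StabDiagram : ℕ → ℕ → Type
  | green (n m : ℕ) (α : StabPhase) : StabDiagram n m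
  | red (n m : ℕ) (β : StabPhase) : StabDiagram n m
  | hadamard : StabDiagram 1 1
  | star : StabDiagram 0 0
  | empty : StabDiagram 0 0
  | wire : StabDiagram 1 1
  | swap : StabDiagram 2 2
  | cup : StabDiagram 0 2
  | cap : StabDiagram 2 0
  | tensor {n m n' m' : ℕ} (D : StabDiagram n m) (D' : StabDiagram n' m') :
      StabDiagram (n + n') (m + m')
  | comp {n m k : ℕ} (D : StabDiagram n m) (D' : StabDiagram m k) : StabDiagram n k

namespace StabDiagram

/-- Matrices of linear maps from `n` qubits to `m` qubits. Rows and columns are indexed by the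
computational basis, that is, by bit strings of length `m` and `n`. -/
abbrev QMatrix (n m : ℕ) : Type := Matrix (Fin m → Fin 2) (Fin n → Fin 2) ℂ

/-- `|0⟩` -/
def ket0 : Fin 2 → ℂ := ![1, 0]

/-- `|1⟩` -/
def ket1 : Fin 2 → ℂ := ![0, 1]

/-- `|+⟩ = (|0⟩ + |1⟩) / √2` -/
def ketPlus : Fin 2 → ℂ := ((1 / Real.sqrt 2 : ℝ) : ℂ) • (ket0 + ket1)

/-- `|-⟩ = (|0⟩ - |1⟩) / √2` -/
def ketMinus : Fin 2 → ℂ := ((1 / Real.sqrt 2 : ℝ) : ℂ) • (ket0 - ket1)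

/-- The `n`-fold tensor power of a one-qubit vector; for `n = 0` it is the scalar `1`. -/
def ketPow (v : Fin 2 → ℂ) (n : ℕ) : (Fin n → Fin 2) → ℂ := fun x => ∏ i, v (x i)

/-- `|v⟩^{⊗ m} ⟨w|^{⊗ n}` -/
def ketBra (v w : Fin 2 → ℂ) (n m : ℕ) : QMatrix n m :=
  Matrix.vecMulVec (ketPow v m) (Star.star (ketPow w n))

/-- The tensor (Kronecker) product of matrices, in terms of concatenated bit strings. -/
def kron {n m n' m' : ℕ} (A : QMatrix n m) (B : QMatrix n' m') : QMatrix (n + n') (m + m') :=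
  Matrix.of fun y x =>
    A (fun i => y (Fin.castAdd m' i)) (fun j => x (Fin.castAdd n' j)) *
      B (fun i => y (Fin.natAdd m i)) (fun j => x (Fin.natAdd n j))

/-- The matrix `⟦D⟧` that a diagram `D` stands for. -/
def interp : {n m : ℕ} → StabDiagram n m → QMatrix n m
  | _, _, green n m α =>
      ketBra ket0 ket0 n m + Complex.exp (Complex.I * α.angle) • ketBra ket1 ket1 n m
  | _, _, red n m β =>
      ketBra ketPlus ketPlus n m + Complex.exp (Complex.I * β.angle) • ketBra ketMinus ketMinus n m
  | _, _, hadamard => ketBra ketPlus ket0 1 1 + ketBra ketMinus ket1 1 1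
  | _, _, star => (1 / 2 : ℂ) • (1 : QMatrix 0 0)
  | _, _, empty => 1
  | _, _, wire => 1
  | _, _, swap => Matrix.of fun y x => if y 0 = x 1 ∧ y 1 = x 0 then 1 else 0
  | _, _, cup => Matrix.of fun y _ => if y 0 = y 1 then 1 else 0
  | _, _, cap => Matrix.of fun _ x => if x 0 = x 1 then 1 else 0
  | _, _, tensor D D' => kron (interp D) (interp D')
  | _, _, comp D D' => interp D' * interp D

/-- The complex number that a scalar diagram stands for: the only entry of its matrix. -/
def scalarValue (D : StabDiagram 0 0) : ℂ := interp D ![] ![]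

end StabDiagram

end

/-!
Every entry of the matrix of a stabilizer diagram is a scalar `√(2 ^ r) e^{isπ/4}` times a quadratic
Gauss sum `S = ∑ v, i ^ q v` over a finite `2`-group `V`, with `q` of degree at most two: this holds
for the generators, and the bits summed over in a matrix product merely enlarge `V`.

Substituting `v + h` for one of the two summation variables in `S * conj S` turns it into a sum over
`h` of the values `i ^ (q h - q 0)` times the sum over `V` of a character depending additively on
`h`. Only the `h` in the radical `R`, where this character is trivial, contribute, and on `R` the
weight `i ^ (q h - q 0)` is itself a character. So `S = 0` or `|S|² = |V| |R|`, a power of two.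
As `S` is a Gaussian integer and `2` is, up to a unit, the square of the prime `1 + i`, in the
second case `S` is a unit times a power of `1 + i = √2 e^{iπ/4}`.
-/

open fwdDiff
open scoped ComplexConjugate

/-- The numbers `√(2 ^ r) e^{isπ/4}`, as a multiplicative monoid. -/
def stabilizerScalars : Submonoid ℂ where
  carrier := {z | ∃ r s : ℤ, z = ((Real.sqrt ((2 : ℝ) ^ r) : ℝ) : ℂ) *
    Complex.exp (Complex.I * (s : ℂ) * (Real.pi : ℂ) / 4)}
  one_mem' := ⟨0, 0, by simp⟩
  mul_mem' := by
    rintro _ _ ⟨r, s, rfl⟩ ⟨r', s', rfl⟩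
    refine ⟨r + r', s + s', ?_⟩
    rw [zpow_add₀ two_ne_zero, Real.sqrt_mul (by positivity), mul_mul_mul_comm, ← Complex.exp_add,
      Complex.ofReal_mul]
    congr 2
    push_cast
    ring

theorem conj_mem_stabilizerScalars {c : ℂ} (hc : c ∈ stabilizerScalars) :
    conj c ∈ stabilizerScalars := by
  obtain ⟨r, s, rfl⟩ := hc
  refine ⟨r, -s, ?_⟩
  rw [map_mul, Complex.conj_ofReal, ← Complex.exp_conj]
  congr 2
  simp only [map_div₀, map_mul, Complex.conj_I, Complex.conj_ofReal, map_intCast, map_ofNat]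
  push_cast
  ring

theorem I_mem_stabilizerScalars : Complex.I ∈ stabilizerScalars := by
  refine ⟨0, 2, ?_⟩
  rw [zpow_zero, Real.sqrt_one, Complex.ofReal_one, one_mul]
  refine Complex.exp_pi_div_two_mul_I.symm.trans (congrArg Complex.exp ?_)
  push_cast
  ring

theorem one_add_I_mem_stabilizerScalars : 1 + Complex.I ∈ stabilizerScalars := by
  have arg_eq : Complex.I * ((1 : ℤ) : ℂ) * Real.pi / 4 = ((Real.pi / 4 : ℝ) : ℂ) * Complex.I := by
    push_cast
    ring
  have sqrtTwo_sq : ((Real.sqrt 2 : ℝ) : ℂ) ^ 2 = 2 := by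
    exact_mod_cast congrArg Complex.ofReal (Real.sq_sqrt zero_le_two)
  refine ⟨1, 1, ?_⟩
  rw [arg_eq, Complex.exp_mul_I, ← Complex.ofReal_cos, ← Complex.ofReal_sin,
    Real.cos_pi_div_four, Real.sin_pi_div_four, zpow_one]
  push_cast
  linear_combination (-(1 + Complex.I) / 2) * sqrtTwo_sq

theorem one_div_sqrtTwo_mem_stabilizerScalars :
    ((1 / Real.sqrt 2 : ℝ) : ℂ) ∈ stabilizerScalars :=
  ⟨-1, 0, by simp⟩

theorem half_mem_stabilizerScalars : (1 / 2 : ℂ) ∈ stabilizerScalars := by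
  convert mul_mem one_div_sqrtTwo_mem_stabilizerScalars one_div_sqrtTwo_mem_stabilizerScalars
    using 1
  rw [← Complex.ofReal_mul, div_mul_div_comm, Real.mul_self_sqrt zero_le_two]
  norm_num

theorem toComplex_mem_stabilizerScalars_of_isUnit {u : GaussianInt} (hu : IsUnit u) :
    (u : ℂ) ∈ stabilizerScalars := by
  have neg_one_mem : (-1 : ℂ) ∈ stabilizerScalars := by
    simpa using mul_mem I_mem_stabilizerScalars I_mem_stabilizerScalars
  obtain ⟨a, b⟩ := u
  have norm_eq : a * a + b * b = 1 := by
    simpa [Zsqrtd.norm_def] using (Zsqrtd.norm_eq_one_iff' (by norm_num) _).2 hu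
  have unit_cases : a = -1 ∧ b = 0 ∨ a = 0 ∧ b = -1 ∨ a = 0 ∧ b = 1 ∨ a = 1 ∧ b = 0 := by
    obtain ⟨ha₁, ha₂⟩ : -1 ≤ a ∧ a ≤ 1 := by constructor <;> nlinarith [mul_self_nonneg b]
    obtain ⟨hb₁, hb₂⟩ : -1 ≤ b ∧ b ≤ 1 := by constructor <;> nlinarith [mul_self_nonneg a]
    interval_cases a <;> interval_cases b <;> lia
  rw [GaussianInt.toComplex_def']
  obtain ⟨rfl, rfl⟩ | ⟨rfl, rfl⟩ | ⟨rfl, rfl⟩ | ⟨rfl, rfl⟩ := unit_cases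
  · simpa using neg_one_mem
  · simpa using mul_mem neg_one_mem I_mem_stabilizerScalars
  · simpa using I_mem_stabilizerScalars
  · simp

theorem prime_one_add_I : Prime (⟨1, 1⟩ : GaussianInt) := by
  have : IsLocalHom (Zsqrtd.normMonoidHom (d := -1)) :=
    ⟨fun z hz => (Zsqrtd.isUnit_iff_norm_isUnit z).2 hz⟩
  have norm_irreducible : Irreducible (Zsqrtd.normMonoidHom (⟨1, 1⟩ : GaussianInt)) :=
    show Irreducible (2 : ℤ) from Int.prime_two.irreducible
  exact norm_irreducible.of_map.prime

theorem toComplex_mem_stabilizerScalars_of_norm_eq_two_pow {z : GaussianInt} {m : ℕ}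
    (hz : z.norm = 2 ^ m) : (z : ℂ) ∈ stabilizerScalars := by
  have two_dvd : (2 : GaussianInt) ∣ ⟨1, 1⟩ ^ 2 := ⟨⟨0, 1⟩, by decide⟩
  have dvd_two_pow : z ∣ 2 ^ m :=
    ⟨star z, by rw [← Zsqrtd.norm_eq_mul_conj, hz]; norm_cast⟩
  have dvd_pow : z ∣ ⟨1, 1⟩ ^ (2 * m) := by
    rw [pow_mul]
    exact dvd_two_pow.trans (pow_dvd_pow_of_dvd two_dvd m)
  obtain ⟨k, -, associated⟩ := (dvd_prime_pow prime_one_add_I _).1 dvd_pow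
  obtain ⟨u, rfl⟩ := associated.symm
  rw [map_mul, map_pow]
  refine mul_mem (pow_mem ?_ k) (toComplex_mem_stabilizerScalars_of_isUnit u.isUnit)
  simpa [GaussianInt.toComplex_def'] using one_add_I_mem_stabilizerScalars

/-- Functions of degree at most two: all third differences vanish. -/
def IsQuadratic {V A : Type*} [AddCommMonoid V] [AddCommGroup A] (q : V → A) : Prop :=
  ∀ x y z v, Δ_[x] (Δ_[y] (Δ_[z] q)) v = 0

namespace IsQuadratic

section Closure

variable {V W A : Type*} [AddCommMonoid V] [AddCommMonoid W] [AddCommGroup A] {q q' : V → A}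

theorem add (hq : IsQuadratic q) (hq' : IsQuadratic q') : IsQuadratic (q + q') :=
  fun x y z v => by
    simp only [fwdDiff_add, Pi.add_apply, hq x y z v, hq' x y z v, add_zero]

theorem neg (hq : IsQuadratic q) : IsQuadratic (-q) := fun x y z v => by
  simp only [← neg_one_smul ℤ q, fwdDiff_const_smul, Pi.smul_apply, hq x y z v, smul_zero]

theorem comp (hq : IsQuadratic q) (φ : W →+ V) : IsQuadratic fun w => q (φ w) :=
  fun x y z w => by
    simpa only [fwdDiff, map_add] using hq (φ x) (φ y) (φ z) (φ w)

theorem comp_add_right (hq : IsQuadratic q) (a : V) : IsQuadratic fun v => q (v + a) :=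
  fun x y z v => by
    simpa only [fwdDiff, add_right_comm _ a] using hq x y z (v + a)

end Closure

section GaussSum

variable {V A K : Type*} [AddCommGroup V] [AddCommGroup A] [RCLike K] {q : V → A}

/-- The polarization of a quadratic function, normalized to be biadditive even if `q 0 ≠ 0`. -/
def polar (hq : IsQuadratic q) : V →+ V →+ A :=
  have add_right (x y z : V) : q (x + (y + z)) - q x - q (y + z) + q 0 =
      q (x + y) - q x - q y + q 0 + (q (x + z) - q x - q z + q 0) := by
    have h := hq x y z 0
    simp only [fwdDiff, zero_add] at h
    rw [← sub_eq_zero, ← h]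
    abel_nf
  .mk' (fun x => .mk' (fun y => q (x + y) - q x - q y + q 0) (add_right x)) fun x y => by
    ext z
    simpa only [AddMonoidHom.mk'_apply, AddMonoidHom.add_apply, add_comm z,
      sub_right_comm _ _ (q z)] using add_right z x y

/-- The biadditive map of a quadratic function, composed with a character of the codomain. -/
def polarChar (hq : IsQuadratic q) (ψ : AddChar A K) : V →+ AddChar V K :=
  .mk' (fun h => ψ.compAddMonoidHom (hq.polar h)) fun x y => by
    ext v
    simp only [AddChar.compAddMonoidHom_apply, map_add, AddMonoidHom.add_apply,
      AddChar.map_add_eq_mul, AddChar.add_apply]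

theorem polarChar_apply (hq : IsQuadratic q) (ψ : AddChar A K) (h v : V) :
    hq.polarChar ψ h v = ψ (q (h + v) - q h - q v + q 0) :=
  rfl

/-- On the radical `(hq.polarChar ψ).ker` the function `ψ ∘ q` is a character up to a constant. -/
def radicalChar (hq : IsQuadratic q) (ψ : AddChar A K) : AddChar (hq.polarChar ψ).ker K where
  toFun h := ψ (q h - q 0)
  map_zero_eq_one' := by rw [ZeroMemClass.coe_zero, sub_self, AddChar.map_zero_eq_one]
  map_add_eq_mul' x y := by
    have polar_eq_one : ψ (q (x + y) - q x - q y + q 0) = 1 :=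
      DFunLike.congr_fun ((hq.polarChar ψ).mem_ker.1 x.2) (y : V)
    rw [AddSubgroup.coe_add, ← AddChar.map_add_eq_mul, ← one_mul (ψ (_ + _)), ← polar_eq_one,
      ← AddChar.map_add_eq_mul]
    congr 1
    abel

variable [Fintype V] [Finite A]

theorem sum_mul_conj (hq : IsQuadratic q) (ψ : AddChar A K) [Fintype (hq.polarChar ψ).ker] :
    (∑ v, ψ (q v)) * conj (∑ v, ψ (q v)) = Fintype.card V * ∑ h, hq.radicalChar ψ h := by
  classical
  calc (∑ v, ψ (q v)) * conj (∑ v, ψ (q v))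
      = ∑ v, ∑ h, ψ (q (h + v) - q v) := by
        rw [map_sum, Finset.mul_sum]
        refine Finset.sum_congr rfl fun v _ => ?_
        rw [← AddChar.map_neg_eq_conj, Finset.sum_mul,
          ← Fintype.sum_equiv (Equiv.addRight v) _ (fun h => ψ (q h) * _) fun _ => rfl]
        simp only [sub_eq_add_neg, AddChar.map_add_eq_mul, Equiv.coe_addRight]
    _ = ∑ h, ψ (q h - q 0) * ∑ v, hq.polarChar ψ h v := by
        rw [Finset.sum_comm]
        refine Finset.sum_congr rfl fun h _ => ?_
        rw [Finset.mul_sum]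
        refine Finset.sum_congr rfl fun v _ => ?_
        rw [polarChar_apply, ← AddChar.map_add_eq_mul]
        congr 1
        abel
    _ = ∑ h with h ∈ (hq.polarChar ψ).ker, Fintype.card V * ψ (q h - q 0) := by
        rw [Finset.sum_filter]
        refine Finset.sum_congr rfl fun h _ => ?_
        simp only [AddChar.sum_eq_ite, AddMonoidHom.mem_ker, mul_comm (ψ _), ite_mul, zero_mul]
    _ = Fintype.card V * ∑ h, hq.radicalChar ψ h := by
        rw [← Finset.mul_sum, ← Finset.sum_subtype_eq_sum_filter, Finset.subtype_univ]
        rfl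

theorem sum_eq_zero_or_sum_mul_conj_eq (hq : IsQuadratic q) (ψ : AddChar A K) :
    ∑ v, ψ (q v) = 0 ∨ (∑ v, ψ (q v)) * conj (∑ v, ψ (q v)) =
      Fintype.card V * Nat.card (hq.polarChar ψ).ker := by
  classical
  have norm_eq := hq.sum_mul_conj ψ
  rw [AddChar.sum_eq_ite] at norm_eq
  split_ifs at norm_eq
  · exact .inr (by rw [norm_eq, Nat.card_eq_fintype_card])
  · refine .inl ?_
    simpa only [mul_zero, mul_eq_zero, map_eq_zero, or_self] using norm_eq

end GaussSum

end IsQuadratic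

theorem stdAddChar_one_zmod_four : ZMod.stdAddChar (1 : ZMod 4) = Complex.I := by
  rw [← Int.cast_one, ZMod.stdAddChar_coe]
  refine (congrArg Complex.exp ?_).trans Complex.exp_pi_div_two_mul_I
  push_cast
  ring

theorem stdAddChar_mem_range_toComplex (a : ZMod 4) :
    ZMod.stdAddChar a ∈ GaussianInt.toComplex.range := by
  have I_mem : Complex.I ∈ GaussianInt.toComplex.range :=
    ⟨⟨0, 1⟩, by simp [GaussianInt.toComplex_def']⟩
  rw [← ZMod.natCast_zmod_val a, ← nsmul_one, AddChar.map_nsmul_eq_pow, stdAddChar_one_zmod_four]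
  exact pow_mem I_mem _

theorem IsQuadratic.sum_stdAddChar_eq_zero_or_mem {V : Type*} [AddCommGroup V] [Fintype V]
    {q : V → ZMod 4} (hq : IsQuadratic q) {k : ℕ} (hV : Fintype.card V = 2 ^ k) :
    ∑ v, ZMod.stdAddChar (q v) = 0 ∨ ∑ v, ZMod.stdAddChar (q v) ∈ stabilizerScalars := by
  refine (hq.sum_eq_zero_or_sum_mul_conj_eq ZMod.stdAddChar).imp_right fun norm_eq => ?_
  obtain ⟨l, -, hl⟩ : ∃ l ≤ k, Nat.card (hq.polarChar ZMod.stdAddChar).ker = 2 ^ l := by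
    rw [← Nat.dvd_prime_pow Nat.prime_two, ← hV, ← Nat.card_eq_fintype_card]
    exact AddSubgroup.card_addSubgroup_dvd_card _
  obtain ⟨z, hz⟩ := sum_mem fun v (_ : v ∈ Finset.univ) => stdAddChar_mem_range_toComplex (q v)
  rw [← hz] at norm_eq ⊢
  refine toComplex_mem_stabilizerScalars_of_norm_eq_two_pow (m := k + l) ?_
  rw [Complex.mul_conj, ← GaussianInt.intCast_complex_norm, hV, hl] at norm_eq
  rw [pow_add]
  exact_mod_cast norm_eq

/-- Partial quadratic Gauss sums over a finite `2`-group `V`, up to a factor `√(2 ^ r) e^{isπ/4}`.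
The existential quantifier ranges over `V : Type`, since bit strings are the only groups needed. -/
def IsGaussSum {X : Type*} [AddCommMonoid X] (f : X → ℂ) : Prop :=
  ∃ (V : Type) (_ : AddCommGroup V) (_ : Fintype V) (c : ℂ) (q : X × V → ZMod 4),
    (∃ k, Fintype.card V = 2 ^ k) ∧ c ∈ stabilizerScalars ∧ IsQuadratic q ∧
      ∀ x, f x = c * ∑ v, ZMod.stdAddChar (q (x, v))

theorem IsQuadratic.isGaussSum {X : Type*} [AddCommMonoid X] {q : X → ZMod 4}
    (hq : IsQuadratic q) : IsGaussSum fun x => ZMod.stdAddChar (q x) :=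
  ⟨Unit, inferInstance, inferInstance, 1, fun p => q p.1, ⟨0, rfl⟩, one_mem _,
    hq.comp (AddMonoidHom.fst X Unit), fun x => by simp⟩

namespace IsGaussSum

variable {X Y : Type*} [AddCommMonoid X] [AddCommMonoid Y] {f f' : X → ℂ}

theorem apply_eq_zero_or_mem (hf : IsGaussSum f) (x : X) : f x = 0 ∨ f x ∈ stabilizerScalars := by
  obtain ⟨V, _, _, c, q, ⟨k, hk⟩, hc, hq, h⟩ := hf
  have slice_quadratic : IsQuadratic fun v => q (x, v) := by
    simpa using (hq.comp_add_right (x, 0)).comp (AddMonoidHom.inr X V)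
  rw [h]
  exact (slice_quadratic.sum_stdAddChar_eq_zero_or_mem hk).imp (mul_eq_zero_of_right c) (mul_mem hc)

theorem const {c : ℂ} (hc : c ∈ stabilizerScalars) : IsGaussSum fun _ : X => c :=
  ⟨Unit, inferInstance, inferInstance, c, 0, ⟨0, rfl⟩, hc,
    fun x y z v => by simp [fwdDiff], fun x => by simp⟩

theorem mul (hf : IsGaussSum f) (hf' : IsGaussSum f') : IsGaussSum (f * f') := by
  obtain ⟨V, _, _, c, q, ⟨k, hk⟩, hc, hq, h⟩ := hf
  obtain ⟨V', _, _, c', q', ⟨k', hk'⟩, hc', hq', h'⟩ := hf'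
  have hq_fst : IsQuadratic fun p : X × V × V' => q (p.1, p.2.1) :=
    hq.comp ((AddMonoidHom.id X).prodMap (AddMonoidHom.fst V V'))
  have hq_snd : IsQuadratic fun p : X × V × V' => q' (p.1, p.2.2) :=
    hq'.comp ((AddMonoidHom.id X).prodMap (AddMonoidHom.snd V V'))
  refine ⟨V × V', inferInstance, inferInstance, c * c', _, ⟨k + k', ?_⟩, mul_mem hc hc',
    hq_fst.add hq_snd, fun x => ?_⟩
  · rw [Fintype.card_prod, hk, hk', pow_add]
  · simp only [Pi.mul_apply, Pi.add_apply, h, h', Fintype.sum_prod_type, mul_mul_mul_comm c,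
      Finset.sum_mul_sum, AddChar.map_add_eq_mul]

theorem prod {ι : Type*} (s : Finset ι) {f : ι → X → ℂ} (hf : ∀ i ∈ s, IsGaussSum (f i)) :
    IsGaussSum (∏ i ∈ s, f i) :=
  Finset.prod_induction f IsGaussSum (fun _ _ => mul) (const (one_mem _)) hf

theorem star (hf : IsGaussSum f) : IsGaussSum fun x => Star.star (f x) := by
  obtain ⟨V, _, _, c, q, hV, hc, hq, h⟩ := hf
  refine ⟨V, _, _, conj c, -q, hV, conj_mem_stabilizerScalars hc, hq.neg, fun x => ?_⟩
  simp only [h, ← starRingEnd_apply, map_mul, map_sum, Pi.neg_apply, AddChar.map_neg_eq_conj]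

theorem comp (hf : IsGaussSum f) (φ : Y →+ X) : IsGaussSum fun y => f (φ y) := by
  obtain ⟨V, _, _, c, q, hV, hc, hq, h⟩ := hf
  exact ⟨V, _, _, c, fun p => q (φ p.1, p.2), hV, hc,
    hq.comp (φ.prodMap (AddMonoidHom.id V)), fun y => h _⟩

theorem sum {Y : Type} [AddCommGroup Y] [Fintype Y] {f : X × Y → ℂ} (hf : IsGaussSum f) {l : ℕ}
    (hY : Fintype.card Y = 2 ^ l) : IsGaussSum fun x => ∑ y, f (x, y) := by
  obtain ⟨V, _, _, c, q, ⟨k, hk⟩, hc, hq, h⟩ := hf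
  have hq_assoc : IsQuadratic fun p : X × Y × V => q ((p.1, p.2.1), p.2.2) :=
    hq.comp (AddEquiv.prodAssoc (M := X) (N := Y) (P := V)).symm.toAddMonoidHom
  refine ⟨Y × V, inferInstance, inferInstance, c, _, ⟨l + k, ?_⟩, hc, hq_assoc, fun x => ?_⟩
  · rw [Fintype.card_prod, hk, hY, pow_add]
  · simp only [h, Fintype.sum_prod_type, Finset.mul_sum]

end IsGaussSum

-- Third differences on `Fin 2` are `0` or `±4 • (q 1 - q 0)`.
theorem isQuadratic_of_fin_two (q : Fin 2 → ZMod 4) : IsQuadratic q := by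
  unfold IsQuadratic fwdDiff
  decide +revert

/-- The product of two bits, embedded in `ZMod 4` so that the standard character maps it to the
sign `(-1) ^ (x * z)`. -/
def bitProduct (p : Fin 2 × Fin 2) : ZMod 4 := if p.1 = 1 ∧ p.2 = 1 then 2 else 0

theorem isQuadratic_bitProduct : IsQuadratic bitProduct := by
  unfold IsQuadratic bitProduct fwdDiff
  decide

theorem stdAddChar_bitProduct (x z : Fin 2) :
    ZMod.stdAddChar (bitProduct (x, z)) = if x = 1 ∧ z = 1 then (-1 : ℂ) else 1 := by
  have stdAddChar_two : ZMod.stdAddChar (2 : ZMod 4) = -1 := by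
    rw [← one_add_one_eq_two, AddChar.map_add_eq_mul, stdAddChar_one_zmod_four, Complex.I_mul_I]
  rw [bitProduct, apply_ite ZMod.stdAddChar, stdAddChar_two, AddChar.map_zero_eq_one]

theorem isGaussSum_ite_eq_zero : IsGaussSum fun x : Fin 2 => if x = 0 then (1 : ℂ) else 0 := by
  convert (IsGaussSum.const half_mem_stabilizerScalars).mul
    (isQuadratic_bitProduct.isGaussSum.sum (l := 1) rfl) using 1
  ext x
  fin_cases x <;> norm_num [stdAddChar_bitProduct]

theorem isGaussSum_ite_eq {X : Type*} [AddCommMonoid X] (φ ψ : X →+ Fin 2) :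
    IsGaussSum fun x => if φ x = ψ x then (1 : ℂ) else 0 := by
  simpa only [AddMonoidHom.sub_apply, sub_eq_zero] using isGaussSum_ite_eq_zero.comp (φ - ψ)

theorem exists_stdAddChar_eq_exp_angle (α : StabPhase) :
    ∃ a : ZMod 4, ZMod.stdAddChar a = Complex.exp (Complex.I * α.angle) := by
  have of_quarter_turns (j : ℤ) (hj : α.angle = j * (Real.pi / 2)) :
      ∃ a : ZMod 4, ZMod.stdAddChar a = Complex.exp (Complex.I * α.angle) := by
    refine ⟨j, ?_⟩
    rw [ZMod.stdAddChar_coe, hj]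
    push_cast
    ring_nf
  cases α
  · exact of_quarter_turns 0 (by simp [StabPhase.angle])
  · exact of_quarter_turns 1 (by simp [StabPhase.angle])
  · exact of_quarter_turns 2 (by rw [StabPhase.angle]; push_cast; ring)
  · exact of_quarter_turns (-1) (by simp [StabPhase.angle])

theorem isGaussSum_phase (α : StabPhase) :
    IsGaussSum ![1, Complex.exp (Complex.I * α.angle)] := by
  obtain ⟨a, ha⟩ := exists_stdAddChar_eq_exp_angle α
  convert (isQuadratic_of_fin_two ![0, a]).isGaussSum using 1
  ext z
  fin_cases z <;> simp [ha]

/-- Matrices, indexed by commutative monoids such as bit strings, whose entries form a partial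
Gauss sum as a function of the row and the column jointly. -/
def IsGaussMatrix {M N : Type*} [AddCommMonoid M] [AddCommMonoid N] (A : Matrix M N ℂ) : Prop :=
  IsGaussSum fun p : M × N => A p.1 p.2

theorem IsGaussMatrix.mul {L N : Type*} {M : Type} [AddCommMonoid L] [AddCommMonoid N]
    [AddCommGroup M] [Fintype M] {B : Matrix L M ℂ} {A : Matrix M N ℂ} {k : ℕ}
    (hB : IsGaussMatrix B) (hA : IsGaussMatrix A) (hM : Fintype.card M = 2 ^ k) :
    IsGaussMatrix (B * A) :=
  ((hB.comp ((AddMonoidHom.fst L N).prodMap (.id M))).mul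
    (hA.comp ((AddMonoidHom.snd (L × N) M).prod
      ((AddMonoidHom.snd L N).comp (AddMonoidHom.fst (L × N) M))))).sum hM

namespace StabDiagram

/-- The projection of the bits indexing a matrix entry to the `i`-th output bit. -/
def outBit (n : ℕ) {m : ℕ} (i : Fin m) : (Fin m → Fin 2) × (Fin n → Fin 2) →+ Fin 2 :=
  .mk' (fun p => p.1 i) fun _ _ => rfl

/-- The projection of the bits indexing a matrix entry to the `j`-th input bit. -/
def inBit {n : ℕ} (m : ℕ) (j : Fin n) : (Fin m → Fin 2) × (Fin n → Fin 2) →+ Fin 2 :=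
  .mk' (fun p => p.2 j) fun _ _ => rfl

theorem isGaussMatrix_kron {n m n' m' : ℕ} {A : QMatrix n m} {B : QMatrix n' m'}
    (hA : IsGaussMatrix A) (hB : IsGaussMatrix B) : IsGaussMatrix (kron A B) :=
  let restrict {a b a' b' : ℕ} (f : Fin a → Fin a') (g : Fin b → Fin b') :
      (Fin a' → Fin 2) × (Fin b' → Fin 2) →+ (Fin a → Fin 2) × (Fin b → Fin 2) :=
    .mk' (fun p => (p.1 ∘ f, p.2 ∘ g)) fun _ _ => rfl
  (hA.comp (restrict (Fin.castAdd m') (Fin.castAdd n'))).mul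
    (hB.comp (restrict (Fin.natAdd m) (Fin.natAdd n)))

theorem isGaussMatrix_one (n : ℕ) : IsGaussMatrix (1 : QMatrix n n) := by
  unfold IsGaussMatrix
  convert IsGaussSum.prod Finset.univ fun i _ => isGaussSum_ite_eq (outBit n i) (inBit n i) with p
  simp [Matrix.one_apply, Finset.prod_apply, Finset.prod_ite_zero, funext_iff, outBit, inBit]

theorem isGaussMatrix_swap :
    IsGaussMatrix (Matrix.of fun y x => if y 0 = x 1 ∧ y 1 = x 0 then 1 else 0 : QMatrix 2 2) := by
  unfold IsGaussMatrix
  convert (isGaussSum_ite_eq (outBit 2 0) (inBit 2 1)).mul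
    (isGaussSum_ite_eq (outBit 2 1) (inBit 2 0)) with p
  simp [← ite_and, and_comm, outBit, inBit]

theorem isGaussMatrix_sum_smul_ketBra {Z : Type} [AddCommGroup Z] [Fintype Z] {k : ℕ}
    (hZ : Fintype.card Z = 2 ^ k) {w : Z → ℂ} (hw : IsGaussSum w) {v v' : Z → Fin 2 → ℂ}
    (hv : IsGaussSum fun p : Fin 2 × Z => v p.2 p.1)
    (hv' : IsGaussSum fun p : Fin 2 × Z => v' p.2 p.1) (n m : ℕ) :
    IsGaussMatrix (∑ z, w z • ketBra (v z) (v' z) n m) := by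
  have ket_gauss := IsGaussSum.prod Finset.univ fun i _ =>
    hv.comp ((outBit n (m := m) i).prodMap (.id Z))
  have bra_gauss := IsGaussSum.prod Finset.univ fun j _ =>
    hv'.star.comp ((inBit (n := n) m j).prodMap (.id Z))
  unfold IsGaussMatrix
  convert ((hw.comp (AddMonoidHom.snd _ Z)).mul (ket_gauss.mul bra_gauss)).sum hZ with p
  simp [Matrix.sum_apply, ketBra, ketPow, Matrix.vecMulVec_apply, Finset.prod_apply, outBit, inBit]

theorem isGaussSum_ket01 : IsGaussSum fun p : Fin 2 × Fin 2 => ![ket0, ket1] p.2 p.1 := by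
  convert isGaussSum_ite_eq (AddMonoidHom.fst (Fin 2) (Fin 2)) (AddMonoidHom.snd (Fin 2) (Fin 2))
    using 2 with p
  obtain ⟨x, z⟩ := p
  fin_cases x <;> fin_cases z <;> simp [ket0, ket1]

theorem isGaussSum_ketPlusMinus :
    IsGaussSum fun p : Fin 2 × Fin 2 => ![ketPlus, ketMinus] p.2 p.1 := by
  convert (IsGaussSum.const one_div_sqrtTwo_mem_stabilizerScalars).mul
    isQuadratic_bitProduct.isGaussSum using 1
  ext ⟨x, z⟩
  fin_cases x <;> fin_cases z <;>
    simp [ketPlus, ketMinus, ket0, ket1, stdAddChar_bitProduct]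

theorem isGaussMatrix_interp {n m : ℕ} (D : StabDiagram n m) : IsGaussMatrix D.interp := by
  induction D with
  | green n m α =>
    simpa [interp] using isGaussMatrix_sum_smul_ketBra (k := 1) rfl (isGaussSum_phase α)
      isGaussSum_ket01 isGaussSum_ket01 n m
  | red n m β =>
    simpa [interp] using isGaussMatrix_sum_smul_ketBra (k := 1) rfl (isGaussSum_phase β)
      isGaussSum_ketPlusMinus isGaussSum_ketPlusMinus n m
  | hadamard =>
    simpa [interp] using isGaussMatrix_sum_smul_ketBra (k := 1) rfl (.const (one_mem _))
      isGaussSum_ketPlusMinus isGaussSum_ket01 1 1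
  | star => exact (IsGaussSum.const half_mem_stabilizerScalars).mul (isGaussMatrix_one 0)
  | empty => exact isGaussMatrix_one 0
  | wire => exact isGaussMatrix_one 1
  | swap => exact isGaussMatrix_swap
  | cup => exact isGaussSum_ite_eq (outBit 0 0) (outBit 0 1)
  | cap => exact isGaussSum_ite_eq (inBit 0 0) (inBit 0 1)
  | tensor D D' ih ih' => exact isGaussMatrix_kron ih ih'
  | @comp n m k D D' ih ih' => exact ih'.mul ih (k := m) (by simp)

end StabDiagram

theorem mainTheorem6_general {n m : ℕ} (D : StabDiagram n m) (y : Fin m → Fin 2)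
    (x : Fin n → Fin 2) (hD : D.interp y x ≠ 0) :
    D.interp y x ∈ {z : ℂ | ∃ r s : ℤ,
      z = ((Real.sqrt ((2 : ℝ) ^ r) : ℝ) : ℂ) *
        Complex.exp (Complex.I * (s : ℂ) * (Real.pi : ℂ) / 4)} :=
  (D.isGaussMatrix_interp.apply_eq_zero_or_mem (y, x)).resolve_left hD

theorem mainTheorem6 (D : StabDiagram 0 0) (hD : D.interp ≠ 0) :
    D.scalarValue ∈ {z : ℂ | ∃ r s : ℤ,
      z = ((Real.sqrt ((2 : ℝ) ^ r) : ℝ) : ℂ) *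
        Complex.exp (Complex.I * (s : ℂ) * (Real.pi : ℂ) / 4)} :=
  mainTheorem6_general D ![] ![] fun h => hD <| Matrix.ext fun y x => by
    rwa [Subsingleton.elim y ![], Subsingleton.elim x ![]]
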